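/- There exist absolute constants $C,c>0$ such that the following holds. For every integer $n\ge 1$ and every $V>0$ there exist design points $x_1<\dots<x_n$, depending only on $n$ and $V$ and geometrically spaced in the sense that $x_i=-\epsilon^i$ ($i=1,\dots,n$) for some $\epsilon\in(0,1/2]$, such that for every $\sigma>0$ and every estimator $\hat{\boldsymbol\mu}$ (a measurable map $\mathbb R^n\to\mathbb R^n$, $\mathbf y\mapsto\hat{\boldsymbol\mu}(\mathbf y)$, which may depend on $n,V,\sigma,x_1,\dots,x_n$), $$ \sup_{\substack{\boldsymbol\mu\in\mathcal K^C_{x_1,\dots,x_n}\cap\mathcal S_n^\uparrow\\ \mu_n-\mu_1\le 2V}} \mathbb P_{\boldsymbol\mu}\left(\frac1n\sum_{i=1}^n\bigl(\hat\mu_i(\mathbf y)-\mu_i\bigr)^2\ \ge\ C\sigma^2\,\min\left\{1,\left(\frac{V^2}{\sigma^2n^2}\right)^{1/3}\right\}\right)\ \ge\ c . $$ Here $\mathbb P_{\boldsymbol\mu}$ is the law of $\mathbf y=\boldsymbol\mu+\boldsymbol\xi$ with $\boldsymbol\xi\sim\mathcal N(\mathbf 0,\sigma^2I_{n\times n})$,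 $\mathcal K^C_{x_1,\dots,x_n}$ is the set of vectors $(f(x_1),\dots,f(x_n))$ with $f:\mathbb R\to\mathbb R$ convex, and $\mathcal S_n^\uparrow$ is the set of nondecreasing vectors in $\mathbb R^n$. When $n\ge V/\sigma$, the minimum is $\left(\frac{V^2}{\sigma^2n^2}\right)^{1/3}=(V/\sigma)^{2/3}n^{-2/3}$, so that for fixed $V$ and $\sigma$ the lower bound is of order $n^{-2/3}$. -/

import Mathlib

open MeasureTheory ProbabilityTheory
open scoped ENNReal NNReal

namespace ShapeRegression

noncomputable section

/-- The squared scaled norm `‖u‖² = (1/n) ∑ i, (u i)²` on `ℝⁿ`. -/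
def scaledNormSq {n : ℕ} (u : Fin n → ℝ) : ℝ :=
  (1 / (n : ℝ)) * ∑ i, u i ^ 2

/-- The cone of vectors `(f (x 1), …, f (x n))` where `f : ℝ → ℝ` is a convex function. -/
def convexCone {n : ℕ} (x : Fin n → ℝ) : Set (Fin n → ℝ) :=
  {u | ∃ f : ℝ → ℝ, ConvexOn ℝ Set.univ f ∧ ∀ i, u i = f (x i)}

/-- The cone of nondecreasing vectors of `ℝⁿ`. -/
def monotoneCone (n : ℕ) : Set (Fin n → ℝ) :=
  {u | Monotone u}

/-- The law of `y = μ + ξ` with `ξ ∼ N(0, σ² I)`: the coordinates of `y` are independent and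
`y i ∼ N(μ i, σ²)`. -/
def obsLaw {n : ℕ} (σ : ℝ) (μ : Fin n → ℝ) : Measure (Fin n → ℝ) :=
  Measure.pi fun i => gaussianReal (μ i) (Real.toNNReal (σ ^ 2))

end

end ShapeRegression

/-! Along `-ε ^ i` the gaps shrink by the factor `ε`, so convexity only asks that each increment be
at least `ε` times the preceding one (`mem_convexCone_geometric`). For small `ε` a staircase with a
slight linear drift satisfies this, so the class contains a full Assouad hypercube, as in isotonic
regression.

Each block of at most `m` coordinates is shifted by `0` or `h = σ / √m`. Flipping one bit moves the
mean by Euclidean distance at most `σ`, which no test detects reliably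
(`quarter_le_obsLaw_add_obsLaw`). Averaging over the cube
(`exists_half_le_measureReal_sum_indicator`) gives a hypothesis under which, with constant
probability, a constant fraction of the coordinates err by at least `h / 2`, a loss of order `σ² /
m`. The range allowed by `V` permits `m` of order `max {1, (σ n / V) ^ (2 / 3)}`
(`exists_block_length`), hence the rate. -/

namespace ShapeRegression

/-! ### Convexity along a geometric design -/

section Interpolation

/-- A sequence of points whose successive slopes are nonnegative and nondecreasing is interpolated
by a convex function which is affine to the right of the last node. -/
lemma exists_convexOn_interpolation (x u s : ℕ → ℝ) (hx : StrictMono x) (hs : Monotone s)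
    (hu : ∀ k, u (k + 1) - u k = s k * (x (k + 1) - x k)) (N : ℕ) :
    ∃ f : ℝ → ℝ, ConvexOn ℝ Set.univ f ∧ (∀ k ≤ N, f (x k) = u k) ∧
      ∀ t, x N ≤ t → f t = u N + s N * (t - x N) := by
  have convex_affine (a b c : ℝ) : ConvexOn ℝ Set.univ (fun t : ℝ => a + b * (t - c)) := by
    refine ⟨convex_univ, fun y _ z _ p q _ _ hpq => le_of_eq ?_⟩
    simp only [smul_eq_mul]
    linear_combination (b * c - a) * hpq
  induction N with
  | zero =>
    refine ⟨fun t => u 0 + s 0 * (t - x 0), convex_affine _ _ _, ?_, fun t _ => rfl⟩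
    intro k hk
    obtain rfl : k = 0 := by omega
    simp
  | succ N ih =>
    obtain ⟨f, hf, hfx, hft⟩ := ih
    have hg : ConvexOn ℝ Set.univ
        (fun t : ℝ => (s (N + 1) - s N) * max 0 (t - x (N + 1))) := by
      have h1 : ConvexOn ℝ Set.univ (fun t : ℝ => max 0 (t - x (N + 1))) := by
        have := (convexOn_const (𝕜 := ℝ) (0 : ℝ) (convex_univ (E := ℝ))).sup
          (convex_affine 0 1 (x (N + 1)))
        refine this.congr fun t _ => ?_
        simp
      have := h1.smul (sub_nonneg.2 (hs (Nat.le_succ N)))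
      simpa only [smul_eq_mul] using this
    have hfN : f (x (N + 1)) = u (N + 1) := by
      rw [hft _ (hx.monotone (Nat.le_succ N)), ← hu]
      ring
    -- The added hinge vanishes up to node `N + 1` and raises the slope from `s N` to `s (N + 1)`
    -- beyond it.
    refine ⟨fun t => f t + (s (N + 1) - s N) * max 0 (t - x (N + 1)), hf.add hg, ?_, ?_⟩
    · intro k hk
      have hle : x k - x (N + 1) ≤ 0 := sub_nonpos.2 (hx.monotone hk)
      simp only [max_eq_left hle, mul_zero, add_zero]
      rcases Nat.lt_or_eq_of_le hk with h | rfl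
      · exact hfx k (by omega)
      · exact hfN
    · intro t ht
      have hNt : x N ≤ t := (hx.monotone (Nat.le_succ N)).trans ht
      simp only [max_eq_right (sub_nonneg.2 ht)]
      rw [hft t hNt]
      linear_combination -hu N

/-- If the increments of a sequence are nonnegative and shrink at most by the factor `ε` from one
step to the next, the sequence is convex along the geometric design `-ε ^ (k + 1)`. -/
lemma mem_convexCone_geometric {n : ℕ} {ε : ℝ} (h0 : 0 < ε) (h1 : ε < 1) (u : ℕ → ℝ)
    (hu : ∀ k, ε * (u (k + 1) - u k) ≤ u (k + 2) - u (k + 1)) :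
    (fun i : Fin n => u i) ∈ convexCone (fun i : Fin n => -ε ^ ((i : ℕ) + 1)) := by
  have hgap (k : ℕ) : -ε ^ (k + 1 + 1) - -ε ^ (k + 1) = ε ^ (k + 1) * (1 - ε) := by ring
  have hpos (k : ℕ) : 0 < ε ^ (k + 1) * (1 - ε) := mul_pos (pow_pos h0 _) (sub_pos.2 h1)
  have hx : StrictMono (fun k : ℕ => -ε ^ (k + 1)) :=
    strictMono_nat_of_lt_succ fun k => sub_pos.1 ((hpos k).trans_eq (hgap k).symm)
  have hs : Monotone (fun k : ℕ => (u (k + 1) - u k) / (ε ^ (k + 1) * (1 - ε))) := by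
    refine monotone_nat_of_le_succ fun k => ?_
    rw [div_le_div_iff₀ (hpos _) (hpos _)]
    have := mul_le_mul_of_nonneg_right (hu k) (hpos k).le
    calc _ = ε * (u (k + 1) - u k) * (ε ^ (k + 1) * (1 - ε)) := by ring
      _ ≤ _ := this
  obtain ⟨f, hf, hfx, -⟩ := exists_convexOn_interpolation (fun k => -ε ^ (k + 1)) u _ hx hs
    (fun k => by rw [hgap, div_mul_cancel₀ _ (hpos k).ne']) n
  exact ⟨f, hf, fun i => (hfx i i.2.le).symm⟩

end Interpolation

/-! ### Indistinguishability of close Gaussian laws -/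

section Gaussian

/-- The likelihood ratio of `N(a + v t, v)` with respect to `N(a, v)`. -/
noncomputable def gaussianRatio (a v t y : ℝ) : ℝ :=
  Real.exp (t * y - (t * a + v * t ^ 2 / 2))

lemma gaussianRatio_eq (a v t y : ℝ) :
    gaussianRatio a v t y = Real.exp (t * y) * Real.exp (-(t * a + v * t ^ 2 / 2)) := by
  rw [gaussianRatio, sub_eq_add_neg, Real.exp_add]

@[fun_prop]
lemma measurable_gaussianRatio (a v t : ℝ) : Measurable (gaussianRatio a v t) := by
  unfold gaussianRatio
  fun_prop

lemma integrable_gaussianRatio (a t : ℝ) (v : ℝ≥0) :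
    Integrable (gaussianRatio a v t) (gaussianReal a v) := by
  have := (integrable_exp_mul_gaussianReal (μ := a) (v := v) t).mul_const
    (Real.exp (-(t * a + v * t ^ 2 / 2)))
  exact this.congr (Filter.Eventually.of_forall fun y => (gaussianRatio_eq a v t y).symm)

lemma gaussianRatio_sq (a v t y : ℝ) :
    gaussianRatio a v t y ^ 2 =
      Real.exp (2 * t * y) * Real.exp (-(2 * (t * a + v * t ^ 2 / 2))) := by
  rw [gaussianRatio, ← Real.exp_nat_mul, ← Real.exp_add]
  congr 1
  push_cast
  ring

lemma integrable_gaussianRatio_sq (a t : ℝ) (v : ℝ≥0) :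
    Integrable (fun y => gaussianRatio a v t y ^ 2) (gaussianReal a v) := by
  simp_rw [gaussianRatio_sq]
  exact (integrable_exp_mul_gaussianReal (2 * t)).mul_const _

lemma integral_gaussianRatio_sq (a t : ℝ) (v : ℝ≥0) :
    ∫ y, gaussianRatio a v t y ^ 2 ∂(gaussianReal a v) = Real.exp (v * t ^ 2) := by
  simp_rw [gaussianRatio_sq, integral_mul_const]
  have h := congrFun (mgf_fun_id_gaussianReal (μ := a) (v := v)) (2 * t)
  rw [mgf] at h
  rw [h, ← Real.exp_add]
  congr 1
  ring

lemma gaussianReal_eq_withDensity_gaussianRatio (a t : ℝ) {v : ℝ≥0} (hv : v ≠ 0) :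
    gaussianReal (a + v * t) v =
      (gaussianReal a v).withDensity fun y => ENNReal.ofReal (gaussianRatio a v t y) := by
  rw [gaussianReal_of_var_ne_zero _ hv, gaussianReal_of_var_ne_zero _ hv,
    ← withDensity_mul _ (measurable_gaussianPDF a v) (by fun_prop)]
  congr 1
  funext y
  have hv' : (v : ℝ) ≠ 0 := by exact_mod_cast hv
  simp only [Pi.mul_apply, gaussianPDF, ← ENNReal.ofReal_mul (gaussianPDFReal_nonneg a v y)]
  congr 1
  rw [gaussianPDFReal, gaussianPDFReal, gaussianRatio, mul_assoc (_)⁻¹, ← Real.exp_add]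
  congr 2
  field_simp
  ring

lemma pi_gaussianReal_eq_withDensity {n : ℕ} (a t : Fin n → ℝ) {v : ℝ≥0} (hv : v ≠ 0) :
    (Measure.pi fun i => gaussianReal (a i + v * t i) v) =
      (Measure.pi fun i => gaussianReal (a i) v).withDensity
        fun y => ENNReal.ofReal (∏ i, gaussianRatio (a i) v (t i) (y i)) := by
  refine Measure.pi_eq fun s hs => ?_
  have hnn (i : Fin n) (y : ℝ) : 0 ≤ gaussianRatio (a i) v (t i) y := (Real.exp_pos _).le
  have hint (i : Fin n) : Integrable (gaussianRatio (a i) v (t i))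
      ((gaussianReal (a i) v).restrict (s i)) := (integrable_gaussianRatio _ _ _).restrict
  rw [withDensity_apply _ (MeasurableSet.univ_pi hs), Measure.restrict_pi_pi,
    ← ofReal_integral_eq_lintegral_ofReal (Integrable.fintype_prod_dep hint)
      (Filter.Eventually.of_forall fun y => Finset.prod_nonneg fun i _ => hnn i _),
    integral_fintype_prod_eq_prod,
    ENNReal.ofReal_prod_of_nonneg fun i _ => integral_nonneg fun y => hnn i y]
  refine Finset.prod_congr rfl fun i _ => ?_
  rw [gaussianReal_eq_withDensity_gaussianRatio _ _ hv, withDensity_apply _ (hs i),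
    ofReal_integral_eq_lintegral_ofReal (hint i) (Filter.Eventually.of_forall (hnn i))]

instance {n : ℕ} (σ : ℝ) (μ : Fin n → ℝ) : IsProbabilityMeasure (obsLaw σ μ) := by
  unfold obsLaw
  infer_instance

/-- Two Gaussian observation laws whose means are at Euclidean distance at most `σ` cannot be
separated: no test has total error probability below `1 / 4`. -/
lemma quarter_le_obsLaw_add_obsLaw {n : ℕ} {σ : ℝ} (hσ : 0 < σ) (μ ν : Fin n → ℝ)
    (hd : ∑ i, (ν i - μ i) ^ 2 ≤ σ ^ 2) {A B : Set (Fin n → ℝ)} (hA : MeasurableSet A)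
    (hAB : A ∪ B = Set.univ) :
    1 / 4 ≤ (obsLaw σ μ).real A + (obsLaw σ ν).real B := by
  set v : ℝ≥0 := Real.toNNReal (σ ^ 2) with hvdef
  have hvσ : (v : ℝ) = σ ^ 2 := Real.coe_toNNReal _ (sq_nonneg σ)
  have hvpos : (0 : ℝ) < v := by rw [hvσ]; positivity
  have hv : v ≠ 0 := by
    intro h
    simp [h] at hvpos
  set t : Fin n → ℝ := fun i => (ν i - μ i) / v with ht
  set L : (Fin n → ℝ) → ℝ := fun y => ∏ i, gaussianRatio (μ i) v (t i) (y i) with hL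
  have hLnn (y) : 0 ≤ L y := Finset.prod_nonneg fun i _ => (Real.exp_pos _).le
  have hLint : Integrable L (obsLaw σ μ) :=
    Integrable.fintype_prod_dep fun i => integrable_gaussianRatio (μ i) (t i) v
  have hL2 : (fun y => L y ^ 2) = fun y => ∏ i, gaussianRatio (μ i) v (t i) (y i) ^ 2 := by
    funext y
    rw [hL, Finset.prod_pow]
  have hL2int : Integrable (fun y => L y ^ 2) (obsLaw σ μ) := by
    rw [hL2]
    exact Integrable.fintype_prod_dep
      (f := fun i y => gaussianRatio (μ i) v (t i) y ^ 2)
      fun i => integrable_gaussianRatio_sq (μ i) (t i) v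
  -- The second moment is the exponential of the squared distance over `σ²`, hence at most `e < 3`.
  have hL2le : ∫ y, L y ^ 2 ∂(obsLaw σ μ) ≤ 3 := by
    rw [hL2, obsLaw, integral_fintype_prod_eq_prod
      (f := fun i y => gaussianRatio (μ i) v (t i) y ^ 2)]
    simp_rw [← hvdef, integral_gaussianRatio_sq]
    rw [← Real.exp_sum]
    have : ∑ i, (v : ℝ) * t i ^ 2 ≤ 1 := by
      have h1 : ∑ i, (v : ℝ) * t i ^ 2 = (∑ i, (ν i - μ i) ^ 2) / σ ^ 2 := by
        rw [Finset.sum_div]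
        refine Finset.sum_congr rfl fun i _ => ?_
        simp only [ht, hvσ]
        field_simp
      rw [h1, div_le_one (by positivity)]
      exact hd
    exact (Real.exp_le_exp.2 this).trans Real.exp_one_lt_three.le
  have hdens : obsLaw σ ν = (obsLaw σ μ).withDensity fun y => ENNReal.ofReal (L y) := by
    rw [obsLaw, obsLaw, ← hvdef, hL, ← pi_gaussianReal_eq_withDensity μ t hv]
    congr 1
    funext i
    congr 1
    simp only [ht]
    field_simp
    ring
  have hQA : (obsLaw σ ν).real A = ∫ y in A, L y ∂(obsLaw σ μ) := by
    rw [Measure.real, hdens, withDensity_apply _ hA,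
      ← ofReal_integral_eq_lintegral_ofReal hLint.restrict
        (Filter.Eventually.of_forall hLnn),
      ENNReal.toReal_ofReal (integral_nonneg hLnn)]
  have hQA_le : (obsLaw σ ν).real A ≤ (obsLaw σ μ).real A + 3 / 4 := by
    rw [hQA]
    -- Pointwise `L ≤ 1 + L² / 4`, since `(L - 2)² ≥ 0`.
    calc ∫ y in A, L y ∂(obsLaw σ μ)
        ≤ ∫ y in A, (1 + L y ^ 2 / 4) ∂(obsLaw σ μ) := by
          refine integral_mono hLint.restrict
            ((integrable_const _).add (hL2int.restrict.div_const 4)) fun y => ?_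
          simp only
          nlinarith [sq_nonneg (L y - 2)]
      _ = (obsLaw σ μ).real A + (∫ y in A, L y ^ 2 ∂(obsLaw σ μ)) / 4 := by
          rw [integral_add (integrable_const _) (hL2int.restrict.div_const 4), integral_div]
          simp
      _ ≤ _ := by
          have := setIntegral_le_integral (s := A) hL2int
            (Filter.Eventually.of_forall fun y => sq_nonneg (L y))
          linarith
  have hone : 1 ≤ (obsLaw σ ν).real A + (obsLaw σ ν).real B := by
    calc (1 : ℝ) = (obsLaw σ ν).real (A ∪ B) := by rw [hAB]; simp
      _ ≤ _ := measureReal_union_le A B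
  linarith

end Gaussian

/-! ### Assouad's averaging argument -/

section Assouad

/-- Assouad's lemma in probability: if every coordinate test fails with total probability at least
`2 * c` on each pair of hypotheses matched by an involution, then under some hypothesis a fraction
`c / 2` of the tests fails with probability at least `c / 2`. -/
lemma exists_half_le_measureReal_sum_indicator {Ω Y ι : Type*} [Fintype Ω] [Nonempty Ω]
    [Fintype ι] [MeasurableSpace Y] (P : Ω → Measure Y) [∀ ω, IsProbabilityMeasure (P ω)]
    (D : Ω → ι → Set Y) (hD : ∀ ω i, MeasurableSet (D ω i)) (e : ι → Ω ≃ Ω) {c : ℝ} (hc : 0 ≤ c)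
    (hι : 0 < Fintype.card ι)
    (h : ∀ ω i, 2 * c ≤ (P ω).real (D ω i) + (P (e i ω)).real (D (e i ω) i)) :
    ∃ ω, c / 2 ≤ (P ω).real
      {y | Fintype.card ι * (c / 2) ≤ ∑ i, (D ω i).indicator (fun _ => (1 : ℝ)) y} := by
  have hι' : (0 : ℝ) < Fintype.card ι := by exact_mod_cast hι
  obtain ⟨ω, hω⟩ : ∃ ω, Fintype.card ι * c ≤ ∑ i, (P ω).real (D ω i) := by
    have hcol (i : ι) : ∑ _ω : Ω, c ≤ ∑ ω, (P ω).real (D ω i) := by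
      have h1 : ∑ ω, (P (e i ω)).real (D (e i ω) i) = ∑ ω, (P ω).real (D ω i) :=
        Equiv.sum_comp (e i) fun ω => (P ω).real (D ω i)
      have h2 := Finset.sum_le_sum fun ω (_ : ω ∈ Finset.univ) => h ω i
      rw [Finset.sum_add_distrib, h1, ← Finset.mul_sum] at h2
      linarith
    have htot : ∑ _ω : Ω, (Fintype.card ι * c : ℝ) ≤ ∑ ω, ∑ i, (P ω).real (D ω i) := by
      rw [Finset.sum_comm]
      refine le_trans (le_of_eq ?_) (Finset.sum_le_sum fun i _ => hcol i)
      simp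
      ring
    obtain ⟨ω, -, hω⟩ := Finset.exists_le_of_sum_le Finset.univ_nonempty htot
    exact ⟨ω, hω⟩
  refine ⟨ω, ?_⟩
  set S : Y → ℝ := fun y => ∑ i, (D ω i).indicator (fun _ => (1 : ℝ)) y with hS
  have hSmeas : Measurable S :=
    Finset.measurable_sum _ fun i _ => measurable_const.indicator (hD ω i)
  set T : Set Y := {y | Fintype.card ι * (c / 2) ≤ S y} with hT
  have hTmeas : MeasurableSet T := measurableSet_le measurable_const hSmeas
  have hind (i : ι) : Integrable ((D ω i).indicator (fun _ => (1 : ℝ))) (P ω) :=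
    (integrable_const 1).indicator (hD ω i)
  have hSint : ∫ y, S y ∂(P ω) = ∑ i, (P ω).real (D ω i) := by
    rw [hS, integral_finsetSum _ fun i _ => hind i]
    exact Finset.sum_congr rfl fun i _ => integral_indicator_one (hD ω i)
  have hSle (y : Y) : S y ≤ Fintype.card ι := by
    calc S y ≤ ∑ _i : ι, (1 : ℝ) :=
          Finset.sum_le_sum fun i _ => Set.indicator_le_self' (fun _ _ => zero_le_one) y
      _ = _ := by simp
  -- Reverse Markov inequality: `S` is below the threshold off `T` and at most the number of tests
  -- on `T`.
  have hbound : ∫ y, S y ∂(P ω) ≤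
      ∫ y, (Fintype.card ι * (c / 2) + T.indicator (fun _ => (Fintype.card ι : ℝ)) y) ∂(P ω) := by
    refine integral_mono (integrable_finsetSum _ fun i _ => hind i)
      ((integrable_const _).add ((integrable_const _).indicator hTmeas)) fun y => ?_
    by_cases hy : y ∈ T
    · simp only [Set.indicator_of_mem hy]
      have := hSle y
      have : 0 ≤ (Fintype.card ι : ℝ) * (c / 2) := by positivity
      linarith
    · simp only [Set.indicator_of_notMem hy, add_zero]
      exact (not_le.1 hy).le
  rw [hSint, integral_add (integrable_const _) ((integrable_const _).indicator hTmeas),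
    integral_indicator hTmeas] at hbound
  simp only [integral_const, probReal_univ, smul_eq_mul, one_mul, measureReal_restrict_apply_univ]
    at hbound
  have hfin : (Fintype.card ι : ℝ) * (c / 2) ≤ Fintype.card ι * (P ω).real T := by
    linarith
  exact le_of_mul_le_mul_left hfin hι'

end Assouad

/-! ### The perturbed staircases and the block length -/

section Hypotheses

/-- The block of length `m` containing position `k`, positions beyond `n - 1` being identified with
`n - 1`. -/
def block (n : ℕ) (hn : 0 < n) (m k : ℕ) : Fin n :=
  ⟨min k (n - 1) / m, (Nat.div_le_self _ _).trans_lt (by omega)⟩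

/-- A staircase with steps of length `m`, perturbed on each block by `0` or `h` according to `ω`,
with an additional linear drift `η`. -/
noncomputable def staircase (n : ℕ) (hn : 0 < n) (m : ℕ) (h η : ℝ) (ω : Fin n → Bool) (k : ℕ) : ℝ :=
  2 * h * ((block n hn m k : ℕ) : ℝ) + h * (if ω (block n hn m k) then 1 else 0) + η * k

variable {n : ℕ} (hn : 0 < n) {m : ℕ}

/-- Entering a new block adds `2 * h` and changes the bit term by at most `h` either way. Such a
jump needs `(n - 1) / m ≥ 1`, so this quotient may be a factor in the upper bound, which is then
exactly `η` when there is a single block. -/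
lemma staircase_succ_sub (hm : 0 < m) {h : ℝ} (hh : 0 ≤ h) (η : ℝ) (ω : Fin n → Bool) (k : ℕ) :
    η ≤ staircase n hn m h η ω (k + 1) - staircase n hn m h η ω k ∧
      staircase n hn m h η ω (k + 1) - staircase n hn m h η ω k ≤
        3 * h * ((n - 1) / m : ℕ) + η := by
  have hq : (0 : ℝ) ≤ ((n - 1) / m : ℕ) := Nat.cast_nonneg _
  have hle : (block n hn m k : ℕ) ≤ block n hn m (k + 1) :=
    Nat.div_le_div_right (by omega)
  have hle' : (block n hn m (k + 1) : ℕ) ≤ block n hn m k + 1 := by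
    have : min (k + 1) (n - 1) ≤ min k (n - 1) + m := by omega
    calc min (k + 1) (n - 1) / m ≤ (min k (n - 1) + m) / m := Nat.div_le_div_right this
      _ = _ := Nat.add_div_right _ hm
  have hqle : (block n hn m (k + 1) : ℕ) ≤ (n - 1) / m :=
    Nat.div_le_div_right (min_le_right _ _)
  unfold staircase
  push_cast
  rcases Nat.lt_or_eq_of_le hle with hlt | heq
  · have hb : (block n hn m (k + 1) : ℕ) = block n hn m k + 1 := by omega
    have hq1 : (1 : ℝ) ≤ ((n - 1) / m : ℕ) := by exact_mod_cast (by omega : 1 ≤ (n - 1) / m)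
    have hhq : h ≤ h * ((n - 1) / m : ℕ) := le_mul_of_one_le_right hh hq1
    rw [hb]
    push_cast
    constructor <;> split_ifs <;> linarith
  · have hb : block n hn m k = block n hn m (k + 1) := Fin.ext heq
    rw [hb]
    have := mul_nonneg hh hq
    constructor <;> linarith

lemma staircase_sub_zero_le {h η V : ℝ} (hh : 0 ≤ h) (hη : n * η ≤ h * ((n - 1) / m : ℕ))
    (hη0 : 0 ≤ η) (hV : 2 * h * ((n - 1) / m : ℕ) ≤ V) (ω : Fin n → Bool) :
    staircase n hn m h η ω (n - 1) - staircase n hn m h η ω 0 ≤ 2 * V := by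
  have hlast : (block n hn m (n - 1) : ℕ) = (n - 1) / m := by simp [block]
  have hzero : (block n hn m 0 : ℕ) = 0 := by simp [block]
  have hdrift : η * ((n - 1 : ℕ) : ℝ) ≤ n * η := by
    rw [mul_comm]
    exact mul_le_mul_of_nonneg_right (by exact_mod_cast Nat.sub_le n 1) hη0
  rcases Nat.eq_zero_or_pos ((n - 1) / m) with hq | hq
  · have hb : block n hn m (n - 1) = block n hn m 0 := Fin.ext (by rw [hlast, hzero, hq])
    rw [hq] at hη hV
    unfold staircase
    rw [hb]
    push_cast at *
    linarith
  · have hq1 : (1 : ℝ) ≤ ((n - 1) / m : ℕ) := by exact_mod_cast hq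
    have hhq : h ≤ h * ((n - 1) / m : ℕ) := le_mul_of_one_le_right hh hq1
    unfold staircase
    rw [hlast, hzero]
    push_cast at *
    split_ifs <;> linarith

lemma card_filter_block_le (hm : 0 < m) (j : Fin n) :
    (Finset.univ.filter fun i : Fin n => block n hn m i = j).card ≤ m := by
  have : (Finset.univ.filter fun i : Fin n => block n hn m i = j).card ≤ (Finset.range m).card := by
    refine Finset.card_le_card_of_injOn (fun i => (i : ℕ) % m)
      (fun i _ => Finset.mem_coe.2 (Finset.mem_range.2 (Nat.mod_lt _ hm))) ?_
    intro a ha b hb hab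
    have key (i : Fin n) (hi : block n hn m i = j) : (i : ℕ) / m = j := by
      rw [← hi]
      simp only [block]
      rw [min_eq_left (by omega)]
    have h1 := key a (by simpa using ha)
    have h2 := key b (by simpa using hb)
    refine Fin.ext ?_
    rw [← Nat.div_add_mod (a : ℕ) m, ← Nat.div_add_mod (b : ℕ) m, h1, h2]
    simpa using hab
  simpa using this

/-- Flipping one bit. -/
def flipBit (j : Fin n) : (Fin n → Bool) ≃ (Fin n → Bool) :=
  Function.Involutive.toPerm (fun ω => Function.update ω j (!ω j)) fun ω => by simp

lemma flipBit_apply (j : Fin n) (ω : Fin n → Bool) :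
    flipBit j ω = Function.update ω j (!ω j) := rfl

lemma staircase_flipBit_sub_sq (h η : ℝ) (ω : Fin n → Bool) (j : Fin n) (k : ℕ) :
    (staircase n hn m h η (flipBit j ω) k - staircase n hn m h η ω k) ^ 2 =
      if block n hn m k = j then h ^ 2 else 0 := by
  unfold staircase
  rw [flipBit_apply]
  split_ifs <;> simp_all

lemma sum_staircase_flipBit_sub_sq_le (hm : 0 < m) (h η : ℝ) (ω : Fin n → Bool) (j : Fin n) :
    ∑ i : Fin n, (staircase n hn m h η (flipBit j ω) i - staircase n hn m h η ω i) ^ 2 ≤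
      m * h ^ 2 := by
  simp_rw [staircase_flipBit_sub_sq]
  rw [← Finset.sum_filter, Finset.sum_const, nsmul_eq_mul]
  exact mul_le_mul_of_nonneg_right (by exact_mod_cast card_filter_block_le hn hm j) (sq_nonneg h)

lemma exists_block_length {n : ℕ} (hn : 0 < n) {σ V : ℝ} (hσ : 0 < σ) (hV : 0 < V) :
    ∃ m : ℕ, 0 < m ∧ 2 * (σ / √m) * ((n - 1) / m : ℕ) ≤ V ∧
      min 1 ((V ^ 2 / (σ ^ 2 * (n : ℝ) ^ 2)) ^ ((1 : ℝ) / 3)) ≤ 3 / m := by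
  have hn' : (0 : ℝ) < n := by exact_mod_cast hn
  set s : ℝ := (V ^ 2 / (σ ^ 2 * (n : ℝ) ^ 2)) ^ ((1 : ℝ) / 3) with hs
  have hs0 : 0 < s := Real.rpow_pos_of_pos (by positivity) _
  have hs3 : s ^ 3 = V ^ 2 / (σ ^ 2 * (n : ℝ) ^ 2) := by
    rw [hs, ← Real.rpow_natCast, ← Real.rpow_mul (by positivity)]
    norm_num
  -- With `m = ⌈2 / s⌉₊` one has `(m s)³ ≥ 8`, more than the `4` that the range bound needs, while
  -- rounding up costs at most `1`, whence the `3`.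
  have hm0 : 0 < ⌈2 / s⌉₊ := Nat.ceil_pos.2 (by positivity)
  refine ⟨⌈2 / s⌉₊, hm0, ?_, ?_⟩
  · set m := ⌈2 / s⌉₊
    have hm' : (0 : ℝ) < m := by exact_mod_cast hm0
    have hms : 2 ≤ m * s := (div_le_iff₀ hs0).1 (Nat.le_ceil (2 / s))
    have hq : (((n - 1) / m : ℕ) : ℝ) ≤ n / m :=
      Nat.cast_div_le.trans (div_le_div_of_nonneg_right (by exact_mod_cast Nat.sub_le n 1) hm'.le)
    calc 2 * (σ / √m) * ((n - 1) / m : ℕ) ≤ 2 * (σ / √m) * (n / m) :=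
          mul_le_mul_of_nonneg_left hq (by positivity)
      _ ≤ V := by
          refine le_of_sq_le_sq ?_ hV.le
          have h8 : (8 : ℝ) ≤ m ^ 3 * (V ^ 2 / (σ ^ 2 * (n : ℝ) ^ 2)) := by
            rw [← hs3, ← mul_pow]
            calc (8 : ℝ) = 2 ^ 3 := by norm_num
              _ ≤ _ := pow_le_pow_left₀ (by norm_num) hms 3
          rw [mul_div_assoc', le_div_iff₀ (by positivity)] at h8
          have : (2 * (σ / √m) * (n / m)) ^ 2 = 4 * (σ ^ 2 * (n : ℝ) ^ 2) / m ^ 3 := by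
            rw [mul_pow, mul_pow, div_pow, Real.sq_sqrt hm'.le]
            field_simp
            ring
          rw [this, div_le_iff₀ (by positivity)]
          nlinarith [show 0 < σ ^ 2 * (n : ℝ) ^ 2 by positivity]
  · have hm' : (0 : ℝ) < (⌈2 / s⌉₊ : ℕ) := by exact_mod_cast hm0
    rw [le_div_iff₀ hm']
    have hceil : ((⌈2 / s⌉₊ : ℕ) : ℝ) ≤ 2 / s + 1 := (Nat.ceil_lt_add_one (by positivity)).le
    have hr0 : 0 ≤ min 1 s := le_min zero_le_one hs0.le
    calc min 1 s * (⌈2 / s⌉₊ : ℕ) ≤ min 1 s * (2 / s + 1) := mul_le_mul_of_nonneg_left hceil hr0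
      _ = min 1 s * (2 / s) + min 1 s := by ring
      _ ≤ s * (2 / s) + 1 :=
          add_le_add (mul_le_mul_of_nonneg_right (min_le_right _ _) (by positivity))
            (min_le_left _ _)
      _ = 3 := by field_simp; norm_num

/-- The squared loss dominates the number of coordinates estimated with error at least `h / 2`. -/
lemma le_scaledNormSq_of_le_sum_indicator (hn : 0 < n) {h c : ℝ} (hh : 0 ≤ h)
    (w : Fin n → ℝ)
    (hw : n * c ≤ ∑ i, if h / 2 ≤ |w i| then (1 : ℝ) else 0) :
    h ^ 2 / 4 * c ≤ scaledNormSq w := by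
  have hn' : (0 : ℝ) < n := by exact_mod_cast hn
  have hterm (i : Fin n) : h ^ 2 / 4 * (if h / 2 ≤ |w i| then (1 : ℝ) else 0) ≤ w i ^ 2 := by
    split_ifs with hi
    · have := pow_le_pow_left₀ (by positivity) hi 2
      rw [sq_abs] at this
      linarith
    · simp [sq_nonneg]
  have hsum := Finset.sum_le_sum fun i (_ : i ∈ Finset.univ) => hterm i
  rw [← Finset.mul_sum] at hsum
  have := (mul_le_mul_of_nonneg_left hw (by positivity : 0 ≤ h ^ 2 / 4)).trans hsum
  rw [scaledNormSq, one_div, ← div_eq_inv_mul, le_div_iff₀ hn']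
  linarith

end Hypotheses

end ShapeRegression

/-! ### The lower bound -/

open ShapeRegression in
theorem mainTheorem6 :
    ∃ C c : ℝ, 0 < C ∧ 0 < c ∧
      ∀ (n : ℕ) (hn : 0 < n) (V : ℝ), 0 < V →
        ∃ x : Fin n → ℝ, StrictMono x ∧
          (∃ ε : ℝ, 0 < ε ∧ ε ≤ 1 / 2 ∧ ∀ i : Fin n, x i = -ε ^ ((i : ℕ) + 1)) ∧
          ∀ σ : ℝ, 0 < σ →
            ∀ muHat : (Fin n → ℝ) → (Fin n → ℝ), Measurable muHat →
              ENNReal.ofReal c ≤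
                ⨆ μ ∈ {μ : Fin n → ℝ |
                    μ ∈ ShapeRegression.convexCone x ∩ ShapeRegression.monotoneCone n ∧
                      μ ⟨n - 1, Nat.sub_lt hn Nat.one_pos⟩ - μ ⟨0, hn⟩ ≤ 2 * V},
                  ShapeRegression.obsLaw σ μ
                    {y | C * σ ^ 2 *
                        min 1 ((V ^ 2 / (σ ^ 2 * (n : ℝ) ^ 2)) ^ ((1 : ℝ) / 3)) ≤
                      ShapeRegression.scaledNormSq (muHat y - μ)} := by
  refine ⟨1 / 192, 1 / 16, by norm_num, by norm_num, fun n hn V hV => ?_⟩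
  have hn1 : (1 : ℝ) ≤ n := by exact_mod_cast hn
  have hn' : (0 : ℝ) < n := by linarith
  -- With the drift `η = h * q / n` chosen below, all increments lie between `η` and `3 * h * q + η
  -- = (3 * n + 1) * η`, so `1 / ε` bounds their ratios.
  set ε : ℝ := 1 / (3 * n + 1) with hε
  have hε0 : 0 < ε := by positivity
  have hε2 : ε ≤ 1 / 2 := one_div_le_one_div_of_le (by norm_num) (by linarith)
  refine ⟨fun i => -ε ^ ((i : ℕ) + 1), ?_, ⟨ε, hε0, hε2, fun i => rfl⟩, ?_⟩
  · intro i j hij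
    exact neg_lt_neg (pow_lt_pow_right_of_lt_one₀ hε0 (by linarith) (by simpa using hij))
  intro σ hσ muHat hmuHat
  obtain ⟨m, hm, hmV, hmr⟩ := exists_block_length hn hσ hV
  have hm' : (0 : ℝ) < m := by exact_mod_cast hm
  set h : ℝ := σ / √m with hh
  have hh0 : 0 < h := by positivity
  have hh2 : h ^ 2 = σ ^ 2 / m := by rw [hh, div_pow, Real.sq_sqrt hm'.le]
  set q : ℝ := (((n - 1) / m : ℕ) : ℝ) with hq
  have hq0 : 0 ≤ q := Nat.cast_nonneg _
  set η : ℝ := h * q / n with hηdef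
  have hη0 : 0 ≤ η := by positivity
  have hη : n * η = h * q := by rw [hηdef]; field_simp
  set u : (Fin n → Bool) → Fin n → ℝ := fun ω i => staircase n hn m h η ω i with hu
  have hstep (ω : Fin n → Bool) (k : ℕ) := staircase_succ_sub hn hm hh0.le η ω k
  have hmem (ω : Fin n → Bool) : u ω ∈ {μ : Fin n → ℝ |
      μ ∈ convexCone (fun i : Fin n => -ε ^ ((i : ℕ) + 1)) ∩ monotoneCone n ∧
        μ ⟨n - 1, Nat.sub_lt hn Nat.one_pos⟩ - μ ⟨0, hn⟩ ≤ 2 * V} := by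
    refine ⟨⟨mem_convexCone_geometric hε0 (by linarith) _ fun k => ?_, ?_⟩,
      staircase_sub_zero_le hn hh0.le hη.le hη0 hmV ω⟩
    · refine le_trans ?_ (hstep ω (k + 1)).1
      rw [hε, div_mul_eq_mul_div, one_mul, div_le_iff₀ (by positivity)]
      linarith [(hstep ω k).2]
    · have hmono : Monotone (staircase n hn m h η ω) :=
        monotone_nat_of_le_succ fun k => by linarith [(hstep ω k).1]
      exact fun i j hij => hmono hij
  have hcoord (i : Fin n) : Measurable fun y => muHat y i := (measurable_pi_apply i).comp hmuHat
  set D : (Fin n → Bool) → Fin n → Set (Fin n → ℝ) :=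
    fun ω i => {y | h / 2 ≤ |muHat y i - u ω i|} with hD
  have hDmeas (ω : Fin n → Bool) (i : Fin n) : MeasurableSet (D ω i) :=
    measurableSet_le measurable_const ((hcoord i).sub_const _).abs
  -- The tests are indexed by coordinates, each testing the bit of its own block, so a shorter last
  -- block needs no special care.
  obtain ⟨ω, hω⟩ := exists_half_le_measureReal_sum_indicator (fun ω => obsLaw σ (u ω)) D hDmeas
    (fun i => flipBit (block n hn m i)) (c := 1 / 8) (by norm_num) (by simpa using hn) (by
      intro ω i
      have hd : ∑ k, (u (flipBit (block n hn m i) ω) k - u ω k) ^ 2 ≤ σ ^ 2 := by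
        refine (sum_staircase_flipBit_sub_sq_le hn hm h η ω _).trans (le_of_eq ?_)
        rw [hh2]
        field_simp
      -- The two means differ by `h` at `i`, so no estimate is within less than `h / 2` of both.
      have hcover : D ω i ∪ D (flipBit (block n hn m i) ω) i = Set.univ := by
        refine Set.eq_univ_of_forall fun y => ?_
        by_contra hy
        simp only [hD, Set.mem_union, Set.mem_ofPred_eq, not_or, not_le] at hy
        have hsep : (u (flipBit (block n hn m i) ω) i - u ω i) ^ 2 = h ^ 2 := by
          simp only [hu, staircase_flipBit_sub_sq, if_true]
        have habs : |u (flipBit (block n hn m i) ω) i - u ω i| = h := by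
          rw [← abs_of_pos hh0]
          exact (sq_eq_sq_iff_abs_eq_abs _ _).1 hsep
        have htri := abs_sub_le (u (flipBit (block n hn m i) ω) i) (muHat y i) (u ω i)
        rw [abs_sub_comm _ (muHat y i)] at htri
        linarith [hy.1, hy.2]
      have := quarter_le_obsLaw_add_obsLaw hσ _ _ hd (hDmeas ω i) hcover
      linarith)
  refine le_iSup₂_of_le (u ω) (hmem ω) ?_
  have hsub : {y | (Fintype.card (Fin n) : ℝ) * (1 / 8 / 2) ≤
      ∑ i, (D ω i).indicator (fun _ => (1 : ℝ)) y} ⊆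
      {y | 1 / 192 * σ ^ 2 * min 1 ((V ^ 2 / (σ ^ 2 * (n : ℝ) ^ 2)) ^ ((1 : ℝ) / 3)) ≤
        scaledNormSq (muHat y - u ω)} := by
    intro y hy
    have hy' := le_scaledNormSq_of_le_sum_indicator (c := 1 / 16) hn hh0.le (muHat y - u ω) (by
      simp only [Set.mem_ofPred_eq, Fintype.card_fin, Set.indicator_apply, hD] at hy
      simp only [Pi.sub_apply]
      linarith)
    refine le_trans ?_ hy'
    calc 1 / 192 * σ ^ 2 * min 1 ((V ^ 2 / (σ ^ 2 * (n : ℝ) ^ 2)) ^ ((1 : ℝ) / 3))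
        ≤ 1 / 192 * σ ^ 2 * (3 / m) := mul_le_mul_of_nonneg_left hmr (by positivity)
      _ = h ^ 2 / 4 * (1 / 16) := by rw [hh2]; ring
  calc ENNReal.ofReal (1 / 16)
      ≤ ENNReal.ofReal ((obsLaw σ (u ω)).real {y | (Fintype.card (Fin n) : ℝ) * (1 / 8 / 2) ≤
          ∑ i, (D ω i).indicator (fun _ => (1 : ℝ)) y}) :=
        ENNReal.ofReal_le_ofReal (by linarith)
    _ = obsLaw σ (u ω) _ := by rw [ofReal_measureReal]
    _ ≤ _ := measure_mono hsub
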